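/- Let $U:[0,1]\times\mathbb{R}^d\to\mathbb{R}$, $(t,x)\mapsto U_t(x)$, be continuously differentiable in $(t,x)$ (with one-sided time derivatives at $t=0,1$; in particular $U$ may be any twice differentiable potential), and suppose that $Z_t=\int_{\mathbb{R}^d}e^{-U_t(x)}\,dx<\infty$ for all $t\in[0,1]$ and that there is an integrable $g:\mathbb{R}^d\to\mathbb{R}$ with $|\partial_tU_t(x)|\,e^{-U_t(x)}\le g(x)$ for all $(t,x)\in[0,1]\times\mathbb{R}^d$ (so that $Z_t$ may be differentiated under the integral sign). Put $\rho_t(x)=Z_t^{-1}e^{-U_t(x)}$ and $F_t=-\log Z_t$ (the free energy). Let $T\in(0,1]$ and let $\hat\rho_t$, $t\in[0,T]$, be any jointly measurable family of probability density functions on $\mathbb{R}^d$ with $\hat\rho_t(x)>0$ for all $(t,x)\in[0,T]\times\mathbb{R}^d$. Call a pair $(\hat b,\hat F)$ with $\hat b:[0,T]\times\mathbb{R}^d\to\mathbb{R}^d$ and $\hat F:[0,T]\to\mathbb{R}$ admissible if * $\hat b$ is continuous in $(t,x)$, and the partial derivatives $\partial_{x_i}\hat b^{\,i}_t(x)$,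 $i=1,\dots,d$, exist and are continuous in $(t,x)$ (so $\nabla\cdot\hat b_t=\sum_i\partial_{x_i}\hat b^{\,i}_t$ is a classical, continuous divergence); * $\hat b_t\rho_t$ has no flux at infinity: for every $t\in[0,T]$ the total outward flux of $\hat b_t\rho_t$ through the boundary of the cube $[-R,R]^d$ tends to $0$ as $R\to\infty$; * $\hat F$ is continuously differentiable on $[0,T]$ and $\hat F_0=-\log Z_0$. For admissible pairs define $$L^T_{\mathrm{PINN}}[\hat b,\hat F]=\int_0^T\!\int_{\mathbb{R}^d}\big|\nabla\cdot\hat b_t(x)-\nabla U_t(x)\cdot\hat b_t(x)-\partial_tU_t(x)+\partial_t\hat F_t\big|^2\,\hat\rho_t(x)\,dx\,dt\in[0,\infty].$$ Then the minimum of $L^T_{\mathrm{PINN}}$ over all admissible pairs exists and equals $0$. Moreover, every admissible minimizer $(b,\hat F)$ satisfies, for all $t\in[0,T]$ and all $x\in\mathbb{R}^d$, the transport equation $\nabla\cdot(b_t\rho_t)(x)=-\partial_t\rho_t(x)$, its equivalent form $\nabla\cdot b_t(x)-\nabla U_t(x)\cdot b_t(x)=\partial_tU_t(x)-\partial_tF_t$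 (where all the derivatives exist), and $\hat F_t=F_t=-\log Z_t$. -/

import Mathlib

open Set Filter Topology MeasureTheory

noncomputable section

namespace NETS

/-- The space `ℝ^d` with the Euclidean structure and Lebesgue measure. -/
abbrev E (d : ℕ) : Type := EuclideanSpace ℝ (Fin d)

variable {d : ℕ}

/-- The partition function `Z_t = ∫ exp (-U_t(x)) dx`. -/
def partitionFn (U : ℝ → E d → ℝ) (t : ℝ) : ℝ := ∫ x, Real.exp (-U t x)

/-- The probability density `ρ_t(x) = Z_t⁻¹ exp (-U_t(x))`. -/
def density (U : ℝ → E d → ℝ) (t : ℝ) (x : E d) : ℝ :=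
  (partitionFn U t)⁻¹ * Real.exp (-U t x)

/-- The free energy `F_t = - log Z_t`. -/
def freeEnergy (U : ℝ → E d → ℝ) (t : ℝ) : ℝ := -Real.log (partitionFn U t)

/-- The time derivative `∂_t U_t(x)` for `t ∈ [0,1]` (one-sided at the two end points). -/
def dtPotential (U : ℝ → E d → ℝ) (t : ℝ) (x : E d) : ℝ :=
  derivWithin (fun s => U s x) (Icc 0 1) t

/-- The partial derivative `∂_i v_i (x)` of the `i`-th component in the `i`-th direction. -/
def diagPartial (v : E d → E d) (i : Fin d) (x : E d) : ℝ :=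
  lineDeriv ℝ (fun y => v y i) x (EuclideanSpace.single i 1)

/-- All the partial derivatives `∂_i v_i (x)` that make up the divergence exist. -/
def HasDiagPartials (v : E d → E d) (x : E d) : Prop :=
  ∀ i, LineDifferentiableAt ℝ (fun y => v y i) x (EuclideanSpace.single i 1)

/-- The divergence `∇ · v = ∑ i, ∂_i v_i`. -/
def divergence (v : E d → E d) (x : E d) : ℝ := ∑ i, diagPartial v i x

/-- The point of `ℝ^d` whose `i`-th coordinate is `r` and whose other coordinates are `y`. -/
def facePoint (i : Fin d) (r : ℝ) (y : {j : Fin d // j ≠ i} → ℝ) : E d :=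
  WithLp.toLp 2 fun j => if h : j = i then r else y ⟨j, h⟩

/-- The outward flux of `v` through the boundary of the cube `[-R,R]^d`: the sum over the
coordinates `i` of the fluxes through the two faces `x_i = R` and `x_i = -R`. -/
def cubeFlux (v : E d → E d) (R : ℝ) : ℝ :=
  ∑ i : Fin d, ∫ y in Icc (fun _ : {j : Fin d // j ≠ i} => -R) (fun _ => R),
    (v (facePoint i R y) i - v (facePoint i (-R) y) i)

/-- `ρ̂_t`, `t ∈ [0,T]`, is a (jointly measurable) family of positive probability densities. -/
structure IsPositivePDF (T : ℝ) (rhoHat : ℝ → E d → ℝ) : Prop where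
  measurable : Measurable (Function.uncurry rhoHat)
  pos : ∀ t ∈ Icc 0 T, ∀ x, 0 < rhoHat t x
  mass : ∀ t ∈ Icc 0 T, ∫⁻ x, ENNReal.ofReal (rhoHat t x) = 1

/-- The residual `∇ · b_t - ∇U_t · b_t - ∂_t U_t + ∂_t F_t` at `(t,x)`, for `t ∈ [0,T]`. -/
def residual (U : ℝ → E d → ℝ) (T : ℝ) (b : ℝ → E d → E d) (F : ℝ → ℝ)
    (t : ℝ) (x : E d) : ℝ :=
  divergence (b t) x - inner ℝ (gradient (U t) x) (b t x) - dtPotential U t x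
    + derivWithin F (Icc 0 T) t

/-- The PINN loss, as an element of `[0,∞]`. -/
def pinnLoss (U : ℝ → E d → ℝ) (T : ℝ) (rhoHat : ℝ → E d → ℝ)
    (b : ℝ → E d → E d) (F : ℝ → ℝ) : ENNReal :=
  ∫⁻ t in Icc 0 T, ∫⁻ x, ENNReal.ofReal (|residual U T b F t x| ^ 2 * rhoHat t x)

/-- The pairs `(b, F)` over which the PINN loss is minimized. -/
structure Admissible (U : ℝ → E d → ℝ) (T : ℝ) (b : ℝ → E d → E d) (F : ℝ → ℝ) : Prop where
  /-- `b` is continuous in `(t,x)`. -/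
  continuousOn : ContinuousOn (Function.uncurry b) (Icc 0 T ×ˢ univ)
  /-- The partial derivatives in the divergence of `b_t` exist ... -/
  hasDiagPartials : ∀ t ∈ Icc 0 T, ∀ x, HasDiagPartials (b t) x
  /-- ... and are continuous in `(t,x)`. -/
  continuousOn_diagPartial : ∀ i,
    ContinuousOn (fun p : ℝ × E d => diagPartial (b p.1) i p.2) (Icc 0 T ×ˢ univ)
  /-- There is no flux of `b_t ρ_t` at infinity. -/
  noFlux : ∀ t ∈ Icc 0 T,
    Tendsto (fun R => cubeFlux (fun x => density U t x • b t x) R) atTop (𝓝 0)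
  /-- `F` is continuously differentiable on `[0,T]`. -/
  contDiffOn : ContDiffOn ℝ 1 F (Icc 0 T)
  /-- The free constant in `F` is fixed by the known value `F_0 = - log Z_0`. -/
  initial : F 0 = freeEnergy U 0

/-- The transport equation `∇ · (b_t ρ_t) = - ∂_t ρ_t` at `(t,x)`, in the classical sense:
the derivatives on both sides exist and the equality holds. -/
def SolvesTransportAt (U : ℝ → E d → ℝ) (b : ℝ → E d → E d) (t : ℝ) (x : E d) : Prop :=
  HasDiagPartials (fun y => density U t y • b t y) x ∧
    HasDerivWithinAt (fun s => density U s x)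
      (-divergence (fun y => density U t y • b t y) x) (Icc 0 1) t

/-- The expanded transport equation `∇ · b_t - ∇U_t · b_t = ∂_t U_t - ∂_t F_t` at `(t,x)`,
where `F` is the free energy of `U`, whose derivative is required to exist. -/
def SolvesExpandedTransportAt (U : ℝ → E d → ℝ) (b : ℝ → E d → E d) (t : ℝ) (x : E d) : Prop :=
  HasDiagPartials (b t) x ∧
    HasDerivWithinAt (freeEnergy U)
      (dtPotential U t x - (divergence (b t) x - inner ℝ (gradient (U t) x) (b t x)))
      (Icc 0 1) t

end NETS

end

namespace NETS

variable {d : ℕ}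

/-! ### Directional partial derivatives and the divergence -/

/-! Since `∇ρ_t = -ρ_t ∇U_t`, one has `∇·(b_t ρ_t) = ρ_t (∇·b_t - ∇U_t·b_t)`
(`divergence_density_smul`), while `-∂_tρ_t = ρ_t (∂_tU_t - ∂_tF_t)`. A zero residual thus says
`∇·(b_t ρ_t) = ρ_t (∂_tU_t - ∂_tF̂_t)`, which is the transport equation as soon as `∂_tF̂ = ∂_tF`.

That last equality comes from integrating over `ℝ^d`. The left side gives the flux at infinity
(`tendsto_cubeFlux`), which is zero by admissibility; the right side gives `∂_tF_t - ∂_tF̂_t`,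
because `∂_tF_t` is the mean of `∂_tU_t` under `ρ_t`. The initial value then yields `F̂ = F`.

The minimum is zero because the loss is nonnegative and some admissible pair attains zero: solve
`∇·m_t = -∂_tρ_t` by integrating along one coordinate, and put `b = m/ρ`, `F̂ = F`. The field `m`
need not decay: its flux through large cubes tends to `∫ -∂_tρ_t = 0`, and only this total flux is
constrained. Conversely, zero loss makes the residual vanish almost everywhere since `ρ̂ > 0`, hence
everywhere by continuity (`Admissible.residual_eq_zero`). -/

theorem HasDiagPartials.hasLineDerivAt_smul {φ : E d → ℝ} {φ' : E d →L[ℝ] ℝ} {v : E d → E d}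
    {x : E d} (hφ : HasFDerivAt φ φ' x) (hv : HasDiagPartials v x) (i : Fin d) :
    HasLineDerivAt ℝ (fun y => (φ y • v y) i)
      (φ x * diagPartial v i x + φ' (EuclideanSpace.single i 1) * v x i) x
      (EuclideanSpace.single i 1) := by
  have h1 : HasLineDerivAt ℝ φ (φ' (EuclideanSpace.single i 1)) x (EuclideanSpace.single i 1) :=
    hφ.hasLineDerivAt _
  have h2 := (hv i).hasLineDerivAt
  unfold HasLineDerivAt at h1 h2 ⊢
  have h3 := h1.mul h2
  simp only [zero_smul, add_zero] at h3
  rw [add_comm]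
  exact h3

theorem HasDiagPartials.smul {φ : E d → ℝ} {φ' : E d →L[ℝ] ℝ} {v : E d → E d}
    {x : E d} (hφ : HasFDerivAt φ φ' x) (hv : HasDiagPartials v x) :
    HasDiagPartials (fun y => φ y • v y) x :=
  fun i => (hv.hasLineDerivAt_smul hφ i).lineDifferentiableAt

theorem HasDiagPartials.diagPartial_smul {φ : E d → ℝ} {φ' : E d →L[ℝ] ℝ} {v : E d → E d}
    {x : E d} (hφ : HasFDerivAt φ φ' x) (hv : HasDiagPartials v x) (i : Fin d) :
    diagPartial (fun y => φ y • v y) i x =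
      φ x * diagPartial v i x + φ' (EuclideanSpace.single i 1) * v x i :=
  (hv.hasLineDerivAt_smul hφ i).lineDeriv

theorem HasDiagPartials.divergence_smul {φ : E d → ℝ} {φ' : E d →L[ℝ] ℝ} {v : E d → E d}
    {x : E d} (hφ : HasFDerivAt φ φ' x) (hv : HasDiagPartials v x) :
    divergence (fun y => φ y • v y) x = φ x * divergence v x + φ' (v x) := by
  have hsum : v x = ∑ i, v x i • EuclideanSpace.single i (1 : ℝ) := by
    simpa using ((EuclideanSpace.basisFun (Fin d) ℝ).sum_repr (v x)).symm
  have hlin : φ' (v x) = ∑ i, φ' (EuclideanSpace.single i 1) * v x i := by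
    conv_lhs => rw [hsum]
    simp [mul_comm]
  simp only [divergence, hv.diagPartial_smul hφ, Finset.sum_add_distrib, Finset.mul_sum, hlin]

/-! ### The divergence theorem on cubes -/

/-- The cube `[-R,R]^d`. -/
def cube (d : ℕ) (R : ℝ) : Set (E d) := {x | ∀ i, x i ∈ Icc (-R) R}

theorem cube_eq_preimage (R : ℝ) :
    cube d R = WithLp.ofLp ⁻¹' (Set.pi univ fun _ => Icc (-R) R) := by
  ext x
  simp [cube, Pi.le_def, forall_and]

theorem isCompact_cube (R : ℝ) : IsCompact (cube d R) := by
  rw [cube_eq_preimage]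
  exact (PiLp.homeomorph 2 (fun _ : Fin d => ℝ)).isCompact_preimage.2
    (isCompact_univ_pi fun _ => isCompact_Icc)

theorem measurableSet_cube (R : ℝ) : MeasurableSet (cube d R) :=
  (isCompact_cube R).isClosed.measurableSet

/-- A point `x` lies in every cube with `R ≥ ‖x‖`; the cover turns limits of cube integrals into
integrals over the whole space. -/
theorem aecover_cube : AECover (volume : Measure (E d)) atTop (cube d) where
  ae_eventually_mem := Eventually.of_forall fun x => by
    filter_upwards [eventually_ge_atTop ‖x‖] with R hR i
    exact abs_le.1 ((PiLp.norm_apply_le x i).trans hR)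
  measurableSet := measurableSet_cube

theorem continuous_facePoint (i : Fin d) :
    Continuous fun q : ℝ × ({j : Fin d // j ≠ i} → ℝ) => facePoint i q.1 q.2 := by
  unfold facePoint
  refine (PiLp.continuous_toLp 2 _).comp (continuous_pi fun j => ?_)
  by_cases h : j = i
  · simpa [h] using continuous_fst
  · simp only [h, dite_false]
    fun_prop

theorem facePoint_add (i : Fin d) (r h : ℝ) (y : {j : Fin d // j ≠ i} → ℝ) :
    facePoint i r y + h • EuclideanSpace.single i 1 = facePoint i (r + h) y := by
  ext j
  by_cases hj : j = i
  · subst hj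
    simp [facePoint]
  · simp [facePoint, hj]

/-- Splitting off the `i`-th coordinate, as a measurable equivalence. -/
def facePointEquiv (i : Fin d) : (ℝ × ({j : Fin d // j ≠ i} → ℝ)) ≃ᵐ E d :=
  (((MeasurableEquiv.funUnique {j : Fin d // j = i} ℝ).symm.prodCongr
      (MeasurableEquiv.refl ({j : Fin d // j ≠ i} → ℝ))).trans
    (MeasurableEquiv.piEquivPiSubtypeProd (fun _ : Fin d => ℝ) fun j => j = i).symm).trans
    (MeasurableEquiv.toLp 2 (Fin d → ℝ))

theorem facePointEquiv_apply (i : Fin d) (q : ℝ × ({j : Fin d // j ≠ i} → ℝ)) :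
    facePointEquiv i q = facePoint i q.1 q.2 := by
  ext j
  by_cases hj : j = i
  · subst hj
    simp [facePointEquiv, facePoint, MeasurableEquiv.piEquivPiSubtypeProd,
      Equiv.piEquivPiSubtypeProd]
    rfl
  · simp [facePointEquiv, facePoint, MeasurableEquiv.piEquivPiSubtypeProd,
      Equiv.piEquivPiSubtypeProd, hj]
    rfl

theorem measurePreserving_facePointEquiv (i : Fin d) :
    MeasurePreserving (facePointEquiv i) := by
  have h1 : MeasurePreserving ((MeasurableEquiv.funUnique {j : Fin d // j = i} ℝ).symm.prodCongr
      (MeasurableEquiv.refl ({j : Fin d // j ≠ i} → ℝ))) :=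
    ((volume_preserving_funUnique {j : Fin d // j = i} ℝ).symm).prod (.id volume)
  have h2 := (volume_preserving_piEquivPiSubtypeProd (fun _ : Fin d => ℝ) fun j => j = i).symm
  -- The product measure over the one-point index type depends formally on a `Fintype` instance; the
  -- two that occur are identified.
  rw [Subsingleton.elim (Subtype.fintype fun j => j = i) (Fintype.subtypeEq i)] at h2
  exact (PiLp.volume_preserving_toLp (Fin d)).comp (h2.comp h1)

theorem facePoint_mem_cube (i : Fin d) (R : ℝ) (q : ℝ × ({j : Fin d // j ≠ i} → ℝ)) :
    facePoint i q.1 q.2 ∈ cube d R ↔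
      q ∈ Icc (-R) R ×ˢ Icc (fun _ : {j : Fin d // j ≠ i} => -R) (fun _ => R) := by
  simp only [cube, mem_ofPred_eq, mem_prod, mem_Icc, Pi.le_def, ← forall_and]
  constructor
  · intro h
    refine ⟨by simpa [facePoint] using h i, fun j => by simpa [facePoint, j.2] using h j⟩
  · rintro ⟨h1, h2⟩ j
    by_cases hj : j = i
    · simpa [facePoint, hj] using h1
    · simpa [facePoint, hj] using h2 ⟨j, hj⟩

theorem hasDerivAt_facePoint {v : E d → E d} (hv : ∀ x, HasDiagPartials v x) (i : Fin d)
    (y : {j : Fin d // j ≠ i} → ℝ) (r : ℝ) :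
    HasDerivAt (fun r => v (facePoint i r y) i) (diagPartial v i (facePoint i r y)) r := by
  have h := (hv (facePoint i r y) i).hasLineDerivAt
  unfold HasLineDerivAt at h
  simp only [facePoint_add] at h
  have h2 := HasDerivAt.comp_sub_const (x := r) (a := r) (by simpa using h)
  simpa [diagPartial] using h2

/-- Fubini splits off the `i`-th coordinate, and the fundamental theorem of calculus applies on each
line. Only the one partial derivative has to exist and be continuous. -/
theorem integral_cube_diagPartial {v : E d → E d} (hv : ∀ x, HasDiagPartials v x) (i : Fin d)
    (hc : Continuous (diagPartial v i)) {R : ℝ} (hR : 0 ≤ R) :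
    ∫ x in cube d R, diagPartial v i x =
      ∫ y in Icc (fun _ : {j : Fin d // j ≠ i} => -R) (fun _ => R),
        (v (facePoint i R y) i - v (facePoint i (-R) y) i) := by
  have hcont : Continuous fun q : ℝ × ({j : Fin d // j ≠ i} → ℝ) =>
    diagPartial v i (facePoint i q.1 q.2) := hc.comp (continuous_facePoint i)
  have hpre : (facePointEquiv i) ⁻¹' cube d R =
      Icc (-R) R ×ˢ Icc (fun _ : {j : Fin d // j ≠ i} => -R) (fun _ => R) := by
    ext q
    rw [mem_preimage, facePointEquiv_apply, facePoint_mem_cube]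
  rw [← (measurePreserving_facePointEquiv i).setIntegral_preimage_emb
    (facePointEquiv i).measurableEmbedding, hpre]
  simp only [facePointEquiv_apply]
  rw [Measure.volume_eq_prod, ← Measure.prod_restrict, integral_prod_symm]
  · refine setIntegral_congr_fun measurableSet_Icc fun y _ => ?_
    simp only
    rw [integral_Icc_eq_integral_Ioc, ← intervalIntegral.integral_of_le (by linarith)]
    refine intervalIntegral.integral_eq_sub_of_hasDerivAt
      (fun r _ => hasDerivAt_facePoint hv i y r) ?_
    exact (hcont.comp (Continuous.prodMk_left y)).intervalIntegrable _ _
  · rw [Measure.prod_restrict, ← Measure.volume_eq_prod]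
    exact hcont.continuousOn.integrableOn_compact (isCompact_Icc.prod isCompact_Icc)

theorem integral_cube_divergence {v : E d → E d} (hv : ∀ x, HasDiagPartials v x)
    (hc : ∀ i, Continuous (diagPartial v i)) {R : ℝ} (hR : 0 ≤ R) :
    ∫ x in cube d R, divergence v x = cubeFlux v R := by
  unfold divergence cubeFlux
  rw [integral_finsetSum _ fun i _ =>
    (hc i).continuousOn.integrableOn_compact (isCompact_cube R)]
  exact Finset.sum_congr rfl fun i _ => integral_cube_diagPartial hv i (hc i) hR

/-- The flux through large cubes converges to the integral of an integrable divergence. -/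
theorem tendsto_cubeFlux {v : E d → E d} (hv : ∀ x, HasDiagPartials v x)
    (hc : ∀ i, Continuous (diagPartial v i)) (hint : Integrable (divergence v)) :
    Tendsto (cubeFlux v) atTop (𝓝 (∫ x, divergence v x)) := by
  refine (aecover_cube.integral_tendsto_of_countably_generated hint).congr' ?_
  filter_upwards [eventually_ge_atTop 0] with R hR
  exact integral_cube_divergence hv hc hR

end NETS

namespace NETS

variable {d : ℕ} {U : ℝ → E d → ℝ} {t : ℝ}

/-! ### Calculus of the potential -/

theorem uniqueDiffOn_slab {T : ℝ} (hT : 0 < T) :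
    UniqueDiffOn ℝ (Icc (0 : ℝ) T ×ˢ (univ : Set (E d))) :=
  (uniqueDiffOn_Icc hT).prod uniqueDiffOn_univ

/-- The total derivative of the potential on the slab `[0,1] × ℝ^d`. -/
noncomputable def totalDeriv (U : ℝ → E d → ℝ) (p : ℝ × E d) : ℝ × E d →L[ℝ] ℝ :=
  fderivWithin ℝ (Function.uncurry U) (Icc 0 1 ×ˢ univ) p

theorem continuousOn_totalDeriv
    (hU : ContDiffOn ℝ 1 (Function.uncurry U) (Icc 0 1 ×ˢ univ)) :
    ContinuousOn (totalDeriv U) (Icc 0 1 ×ˢ univ) :=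
  hU.continuousOn_fderivWithin (uniqueDiffOn_slab one_pos) le_rfl

theorem hasFDerivWithinAt_totalDeriv
    (hU : ContDiffOn ℝ 1 (Function.uncurry U) (Icc 0 1 ×ˢ univ)) (ht : t ∈ Icc (0 : ℝ) 1)
    (x : E d) :
    HasFDerivWithinAt (Function.uncurry U) (totalDeriv U (t, x)) (Icc 0 1 ×ˢ univ) (t, x) :=
  (hU.differentiableOn one_ne_zero (t, x) ⟨ht, mem_univ x⟩).hasFDerivWithinAt

theorem hasDerivWithinAt_time
    (hU : ContDiffOn ℝ 1 (Function.uncurry U) (Icc 0 1 ×ˢ univ)) (ht : t ∈ Icc (0 : ℝ) 1)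
    (x : E d) :
    HasDerivWithinAt (fun s => U s x) (totalDeriv U (t, x) (1, 0)) (Icc 0 1) t := by
  have h1 : HasDerivWithinAt (fun s : ℝ => (s, x)) ((1 : ℝ), (0 : E d)) (Icc 0 1) t :=
    (hasDerivWithinAt_id t _).prodMk (hasDerivWithinAt_const t _ x)
  have hmaps : MapsTo (fun s : ℝ => (s, x)) (Icc 0 1) (Icc 0 1 ×ˢ univ) :=
    fun s hs => ⟨hs, mem_univ x⟩
  exact (hasFDerivWithinAt_totalDeriv hU ht x).comp_hasDerivWithinAt t h1 hmaps

theorem dtPotential_eq_totalDeriv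
    (hU : ContDiffOn ℝ 1 (Function.uncurry U) (Icc 0 1 ×ˢ univ)) (ht : t ∈ Icc (0 : ℝ) 1)
    (x : E d) : dtPotential U t x = totalDeriv U (t, x) (1, 0) :=
  (hasDerivWithinAt_time hU ht x).derivWithin (uniqueDiffOn_Icc one_pos t ht)

theorem hasDerivWithinAt_dtPotential
    (hU : ContDiffOn ℝ 1 (Function.uncurry U) (Icc 0 1 ×ˢ univ)) (ht : t ∈ Icc (0 : ℝ) 1)
    (x : E d) : HasDerivWithinAt (fun s => U s x) (dtPotential U t x) (Icc 0 1) t := by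
  rw [dtPotential_eq_totalDeriv hU ht]
  exact hasDerivWithinAt_time hU ht x

theorem continuousOn_dtPotential
    (hU : ContDiffOn ℝ 1 (Function.uncurry U) (Icc 0 1 ×ˢ univ)) :
    ContinuousOn (fun p : ℝ × E d => dtPotential U p.1 p.2) (Icc 0 1 ×ˢ univ) :=
  ((continuousOn_totalDeriv hU).clm_apply continuousOn_const).congr
    fun p hp => dtPotential_eq_totalDeriv hU hp.1 p.2

/-- The slab restricts time only, so the spatial derivative is a full Fréchet derivative even at `t
= 0` and `t = 1`. -/
theorem hasFDerivAt_space
    (hU : ContDiffOn ℝ 1 (Function.uncurry U) (Icc 0 1 ×ˢ univ)) (ht : t ∈ Icc (0 : ℝ) 1)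
    (x : E d) :
    HasFDerivAt (U t) ((totalDeriv U (t, x)).comp (ContinuousLinearMap.inr ℝ ℝ (E d))) x := by
  rw [← hasFDerivWithinAt_univ]
  exact (hasFDerivWithinAt_totalDeriv hU ht x).comp x (hasFDerivAt_prodMk_right t x).hasFDerivWithinAt
    fun y _ => ⟨ht, mem_univ y⟩

theorem inner_gradient_eq_totalDeriv
    (hU : ContDiffOn ℝ 1 (Function.uncurry U) (Icc 0 1 ×ˢ univ)) (ht : t ∈ Icc (0 : ℝ) 1)
    (x v : E d) : inner ℝ (gradient (U t) x) v = totalDeriv U (t, x) (0, v) := by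
  rw [inner_gradient_left, (hasFDerivAt_space hU ht x).fderiv]
  rfl

theorem continuous_potential
    (hU : ContDiffOn ℝ 1 (Function.uncurry U) (Icc 0 1 ×ˢ univ)) (ht : t ∈ Icc (0 : ℝ) 1) :
    Continuous (U t) :=
  hU.continuousOn.comp_continuous (Continuous.prodMk_right t) fun x => ⟨ht, mem_univ x⟩

theorem continuous_dtPotential
    (hU : ContDiffOn ℝ 1 (Function.uncurry U) (Icc 0 1 ×ˢ univ)) (ht : t ∈ Icc (0 : ℝ) 1) :
    Continuous (dtPotential U t) :=
  (continuousOn_dtPotential hU).comp_continuous (Continuous.prodMk_right t)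
    fun x => ⟨ht, mem_univ x⟩

theorem hasDerivWithinAt_exp_neg
    (hU : ContDiffOn ℝ 1 (Function.uncurry U) (Icc 0 1 ×ˢ univ)) (ht : t ∈ Icc (0 : ℝ) 1)
    (x : E d) :
    HasDerivWithinAt (fun s => Real.exp (-U s x)) (-(dtPotential U t x * Real.exp (-U t x)))
      (Icc 0 1) t := by
  refine (hasDerivWithinAt_dtPotential hU ht x).neg.exp.congr_deriv ?_
  simp only [Pi.neg_apply]
  ring

/-! ### The partition function and the free energy -/

theorem partitionFn_pos (hZ : Integrable fun x => Real.exp (-U t x)) : 0 < partitionFn U t :=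
  integral_exp_pos hZ

theorem density_pos (hZ : Integrable fun x => Real.exp (-U t x)) (x : E d) :
    0 < density U t x :=
  mul_pos (inv_pos.2 (partitionFn_pos hZ)) (Real.exp_pos _)

theorem integrable_density (hZ : Integrable fun x => Real.exp (-U t x)) :
    Integrable (density U t) := hZ.const_mul _

theorem integral_density (hZ : Integrable fun x => Real.exp (-U t x)) :
    ∫ x, density U t x = 1 := by
  simp only [density]
  rw [integral_const_mul]
  exact inv_mul_cancel₀ (partitionFn_pos hZ).ne'

/-- Dominated convergence for difference quotients within `[0,1]`, which covers the one-sided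
derivatives at the end points. -/
theorem hasDerivWithinAt_partitionFn
    (hU : ContDiffOn ℝ 1 (Function.uncurry U) (Icc 0 1 ×ˢ univ))
    (hZ : ∀ t ∈ Icc (0 : ℝ) 1, Integrable (fun x => Real.exp (-U t x)))
    {g : E d → ℝ} (hg : Integrable g) (hgb : ∀ t ∈ Icc (0 : ℝ) 1, ∀ x,
      |dtPotential U t x| * Real.exp (-U t x) ≤ g x) (ht : t ∈ Icc (0 : ℝ) 1) :
    HasDerivWithinAt (partitionFn U) (-∫ x, dtPotential U t x * Real.exp (-U t x))
      (Icc 0 1) t := by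
  rw [hasDerivWithinAt_iff_tendsto_slope, ← integral_neg]
  have hmem : ∀ᶠ s in 𝓝[Icc 0 1 \ {t}] t, s ∈ Icc (0 : ℝ) 1 \ {t} := self_mem_nhdsWithin
  have key : Tendsto (fun s => ∫ x, slope (fun r => Real.exp (-U r x)) t s)
      (𝓝[Icc 0 1 \ {t}] t) (𝓝 (∫ x, -(dtPotential U t x * Real.exp (-U t x)))) := by
    refine tendsto_integral_filter_of_dominated_convergence g ?_ ?_ hg ?_
    · filter_upwards [hmem] with s hs
      exact (((hZ s hs.1).sub (hZ t ht)).const_mul (s - t)⁻¹).aestronglyMeasurable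
    · filter_upwards [hmem] with s hs
      refine Eventually.of_forall fun x => ?_
      have hne : 0 < ‖s - t‖ := norm_pos_iff.2 (sub_ne_zero.2 hs.2)
      -- The bound by `g x` is uniform in time, so the mean value inequality passes it from the
      -- derivative to the slopes.
      have := (convex_Icc (0 : ℝ) 1).norm_image_sub_le_of_norm_hasDerivWithin_le
        (f := fun r => Real.exp (-U r x)) (C := g x)
        (fun r hr => hasDerivWithinAt_exp_neg hU hr x)
        (fun r hr => by
          rw [norm_neg, norm_mul, Real.norm_eq_abs, Real.norm_eq_abs, Real.abs_exp]
          exact hgb r hr x) ht hs.1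
      rw [slope_def_field, norm_div, div_le_iff₀ hne]
      exact this
    · exact Eventually.of_forall fun x =>
        hasDerivWithinAt_iff_tendsto_slope.1 (hasDerivWithinAt_exp_neg hU ht x)
  refine key.congr' ?_
  filter_upwards [hmem] with s hs
  simp only [slope_def_field, partitionFn]
  rw [integral_div, integral_sub (hZ s hs.1) (hZ t ht)]

/-- The time derivative `∫ ∂_t U_t ρ_t` of the free energy. -/
noncomputable def dtFreeEnergy (U : ℝ → E d → ℝ) (t : ℝ) : ℝ :=
  (partitionFn U t)⁻¹ * ∫ x, dtPotential U t x * Real.exp (-U t x)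

theorem hasDerivWithinAt_freeEnergy
    (hU : ContDiffOn ℝ 1 (Function.uncurry U) (Icc 0 1 ×ˢ univ))
    (hZ : ∀ t ∈ Icc (0 : ℝ) 1, Integrable (fun x => Real.exp (-U t x)))
    {g : E d → ℝ} (hg : Integrable g) (hgb : ∀ t ∈ Icc (0 : ℝ) 1, ∀ x,
      |dtPotential U t x| * Real.exp (-U t x) ≤ g x) (ht : t ∈ Icc (0 : ℝ) 1) :
    HasDerivWithinAt (freeEnergy U) (dtFreeEnergy U t) (Icc 0 1) t := by
  refine ((hasDerivWithinAt_partitionFn hU hZ hg hgb ht).log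
    (partitionFn_pos (hZ t ht)).ne').neg.congr_deriv ?_
  rw [dtFreeEnergy, div_eq_inv_mul]
  ring

theorem continuousOn_partitionFn
    (hU : ContDiffOn ℝ 1 (Function.uncurry U) (Icc 0 1 ×ˢ univ))
    (hZ : ∀ t ∈ Icc (0 : ℝ) 1, Integrable (fun x => Real.exp (-U t x)))
    {g : E d → ℝ} (hg : Integrable g) (hgb : ∀ t ∈ Icc (0 : ℝ) 1, ∀ x,
      |dtPotential U t x| * Real.exp (-U t x) ≤ g x) :
    ContinuousOn (partitionFn U) (Icc 0 1) :=
  fun _ ht => (hasDerivWithinAt_partitionFn hU hZ hg hgb ht).continuousWithinAt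

theorem continuousOn_dtFreeEnergy
    (hU : ContDiffOn ℝ 1 (Function.uncurry U) (Icc 0 1 ×ˢ univ))
    (hZ : ∀ t ∈ Icc (0 : ℝ) 1, Integrable (fun x => Real.exp (-U t x)))
    {g : E d → ℝ} (hg : Integrable g) (hgb : ∀ t ∈ Icc (0 : ℝ) 1, ∀ x,
      |dtPotential U t x| * Real.exp (-U t x) ≤ g x) :
    ContinuousOn (dtFreeEnergy U) (Icc 0 1) := by
  refine ((continuousOn_partitionFn hU hZ hg hgb).inv₀
    fun t ht => (partitionFn_pos (hZ t ht)).ne').mul ?_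
  refine continuousOn_of_dominated (bound := g) (fun t ht => ?_) (fun t ht => ?_) hg ?_
  · exact ((continuous_dtPotential hU ht).mul
      (continuous_potential hU ht).neg.rexp).aestronglyMeasurable
  · refine Eventually.of_forall fun x => ?_
    rw [norm_mul, Real.norm_eq_abs, Real.norm_eq_abs, Real.abs_exp]
    exact hgb t ht x
  · refine Eventually.of_forall fun x => ?_
    have hx : ContinuousOn (fun t : ℝ => (t, x)) (Icc 0 1) := by fun_prop
    have hmaps : MapsTo (fun t : ℝ => (t, x)) (Icc 0 1) (Icc 0 1 ×ˢ univ) :=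
      fun s hs => ⟨hs, mem_univ x⟩
    exact ((continuousOn_dtPotential hU).comp hx hmaps).mul
      ((hU.continuousOn.comp hx hmaps).neg.rexp)

theorem contDiffOn_freeEnergy
    (hU : ContDiffOn ℝ 1 (Function.uncurry U) (Icc 0 1 ×ˢ univ))
    (hZ : ∀ t ∈ Icc (0 : ℝ) 1, Integrable (fun x => Real.exp (-U t x)))
    {g : E d → ℝ} (hg : Integrable g) (hgb : ∀ t ∈ Icc (0 : ℝ) 1, ∀ x,
      |dtPotential U t x| * Real.exp (-U t x) ≤ g x) :
    ContDiffOn ℝ 1 (freeEnergy U) (Icc 0 1) := by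
  have hd := fun t (ht : t ∈ Icc (0 : ℝ) 1) => hasDerivWithinAt_freeEnergy hU hZ hg hgb ht
  rw [contDiffOn_one_iff_derivWithin (uniqueDiffOn_Icc one_pos)]
  refine ⟨fun t ht => (hd t ht).differentiableWithinAt,
    (continuousOn_dtFreeEnergy hU hZ hg hgb).congr fun t ht =>
      (hd t ht).derivWithin (uniqueDiffOn_Icc one_pos t ht)⟩

theorem integrable_dtPotential_mul_exp
    (hU : ContDiffOn ℝ 1 (Function.uncurry U) (Icc 0 1 ×ˢ univ))
    {g : E d → ℝ} (hg : Integrable g) (hgb : ∀ t ∈ Icc (0 : ℝ) 1, ∀ x,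
      |dtPotential U t x| * Real.exp (-U t x) ≤ g x) (ht : t ∈ Icc (0 : ℝ) 1) :
    Integrable fun x => dtPotential U t x * Real.exp (-U t x) := by
  refine hg.mono' ((continuous_dtPotential hU ht).mul
    (continuous_potential hU ht).neg.rexp).aestronglyMeasurable (Eventually.of_forall fun x => ?_)
  rw [norm_mul, Real.norm_eq_abs, Real.norm_eq_abs, Real.abs_exp]
  exact hgb t ht x

theorem integrable_density_mul_dtPotential_sub
    (hU : ContDiffOn ℝ 1 (Function.uncurry U) (Icc 0 1 ×ˢ univ))
    (hZ : ∀ t ∈ Icc (0 : ℝ) 1, Integrable (fun x => Real.exp (-U t x)))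
    {g : E d → ℝ} (hg : Integrable g) (hgb : ∀ t ∈ Icc (0 : ℝ) 1, ∀ x,
      |dtPotential U t x| * Real.exp (-U t x) ≤ g x) (ht : t ∈ Icc (0 : ℝ) 1) (c : ℝ) :
    Integrable fun x => density U t x * (dtPotential U t x - c) := by
  have h1 := (integrable_dtPotential_mul_exp hU hg hgb ht).const_mul (partitionFn U t)⁻¹
  have h2 := (integrable_density (hZ t ht)).mul_const c
  refine (h1.sub h2).congr (Eventually.of_forall fun x => ?_)
  simp only [density, Pi.sub_apply]
  ring

/-- Used twice: with `c = dtFreeEnergy U t` the integral vanishes, which makes the constructed field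
flux-free; with `c` the derivative of a learned `F` it identifies that derivative. -/
theorem integral_density_mul_dtPotential_sub
    (hU : ContDiffOn ℝ 1 (Function.uncurry U) (Icc 0 1 ×ˢ univ))
    (hZ : ∀ t ∈ Icc (0 : ℝ) 1, Integrable (fun x => Real.exp (-U t x)))
    {g : E d → ℝ} (hg : Integrable g) (hgb : ∀ t ∈ Icc (0 : ℝ) 1, ∀ x,
      |dtPotential U t x| * Real.exp (-U t x) ≤ g x) (ht : t ∈ Icc (0 : ℝ) 1) (c : ℝ) :
    ∫ x, density U t x * (dtPotential U t x - c) = dtFreeEnergy U t - c := by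
  have h1 := (integrable_dtPotential_mul_exp hU hg hgb ht).const_mul (partitionFn U t)⁻¹
  have h2 := (integrable_density (hZ t ht)).mul_const c
  have h3 : ∀ x, density U t x * (dtPotential U t x - c) =
      (partitionFn U t)⁻¹ * (dtPotential U t x * Real.exp (-U t x)) - density U t x * c := by
    intro x
    simp only [density]
    ring
  simp only [h3]
  rw [integral_sub h1 h2, integral_const_mul, integral_mul_const, integral_density (hZ t ht),
    one_mul, dtFreeEnergy]

/-! ### The density -/

theorem hasFDerivAt_density
    (hU : ContDiffOn ℝ 1 (Function.uncurry U) (Icc 0 1 ×ˢ univ)) (ht : t ∈ Icc (0 : ℝ) 1)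
    (x : E d) :
    HasFDerivAt (density U t)
      (-(density U t x • (totalDeriv U (t, x)).comp (ContinuousLinearMap.inr ℝ ℝ (E d)))) x := by
  refine (((hasFDerivAt_space hU ht x).neg.exp).const_mul (partitionFn U t)⁻¹).congr_fderiv ?_
  rw [density, smul_neg, smul_neg, smul_smul]
  rfl

/-- Here `1/ρ = Z exp U`. This differentiates the factor in `b = ρ⁻¹ m`. -/
theorem hasFDerivAt_density_inv
    (hU : ContDiffOn ℝ 1 (Function.uncurry U) (Icc 0 1 ×ˢ univ)) (ht : t ∈ Icc (0 : ℝ) 1)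
    (x : E d) :
    HasFDerivAt (fun y => (density U t y)⁻¹)
      ((density U t x)⁻¹ • (totalDeriv U (t, x)).comp (ContinuousLinearMap.inr ℝ ℝ (E d))) x := by
  have h : (fun y => (density U t y)⁻¹) = fun y => partitionFn U t * Real.exp (U t y) := by
    ext y
    rw [density, mul_inv, inv_inv, Real.exp_neg, inv_inv]
  rw [h, congrFun h x]
  refine (((hasFDerivAt_space hU ht x).exp).const_mul (partitionFn U t)).congr_fderiv ?_
  rw [smul_smul]

theorem divergence_density_smul
    (hU : ContDiffOn ℝ 1 (Function.uncurry U) (Icc 0 1 ×ˢ univ)) (ht : t ∈ Icc (0 : ℝ) 1)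
    {v : E d → E d} {x : E d} (hv : HasDiagPartials v x) :
    divergence (fun y => density U t y • v y) x =
      density U t x * (divergence v x - inner ℝ (gradient (U t) x) (v x)) := by
  rw [hv.divergence_smul (hasFDerivAt_density hU ht x), inner_gradient_eq_totalDeriv hU ht]
  simp
  ring

theorem hasDerivWithinAt_density
    (hU : ContDiffOn ℝ 1 (Function.uncurry U) (Icc 0 1 ×ˢ univ))
    (hZ : ∀ t ∈ Icc (0 : ℝ) 1, Integrable (fun x => Real.exp (-U t x)))
    {g : E d → ℝ} (hg : Integrable g) (hgb : ∀ t ∈ Icc (0 : ℝ) 1, ∀ x,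
      |dtPotential U t x| * Real.exp (-U t x) ≤ g x) (ht : t ∈ Icc (0 : ℝ) 1) (x : E d) :
    HasDerivWithinAt (fun s => density U s x)
      (-(density U t x * (dtPotential U t x - dtFreeEnergy U t))) (Icc 0 1) t := by
  have hpos := (partitionFn_pos (hZ t ht)).ne'
  refine (((hasDerivWithinAt_partitionFn hU hZ hg hgb ht).inv hpos).mul
    (hasDerivWithinAt_exp_neg hU ht x)).congr_deriv ?_
  simp only [density, dtFreeEnergy, Pi.inv_apply]
  field_simp
  ring

theorem continuousOn_density
    (hU : ContDiffOn ℝ 1 (Function.uncurry U) (Icc 0 1 ×ˢ univ))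
    (hZ : ∀ t ∈ Icc (0 : ℝ) 1, Integrable (fun x => Real.exp (-U t x)))
    {g : E d → ℝ} (hg : Integrable g) (hgb : ∀ t ∈ Icc (0 : ℝ) 1, ∀ x,
      |dtPotential U t x| * Real.exp (-U t x) ≤ g x) :
    ContinuousOn (Function.uncurry (density U)) (Icc 0 1 ×ˢ univ) := by
  have h1 : ContinuousOn (fun p : ℝ × E d => partitionFn U p.1) (Icc 0 1 ×ˢ univ) :=
    (continuousOn_partitionFn hU hZ hg hgb).comp continuousOn_fst fun p hp => hp.1
  exact (h1.inv₀ fun p hp => (partitionFn_pos (hZ p.1 hp.1)).ne').mul hU.continuousOn.neg.rexp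

end NETS

namespace NETS

variable {d : ℕ} {U : ℝ → E d → ℝ} {t : ℝ}

/-! ### A vector field with prescribed divergence -/

/-- The primitive of `f t` in the direction of the zeroth coordinate. -/
noncomputable def primitive {n : ℕ} (f : ℝ × E (n + 1) → ℝ) (p : ℝ × E (n + 1)) : ℝ :=
  ∫ s in (0 : ℝ)..p.2 0, f (p.1, p.2 + (s - p.2 0) • EuclideanSpace.single 0 1)

theorem continuous_primitive {n : ℕ} {f : ℝ × E (n + 1) → ℝ} (hf : Continuous f) :
    Continuous (primitive f) := by
  refine intervalIntegral.continuous_parametric_intervalIntegral_of_continuous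
    (f := fun (p : ℝ × E (n + 1)) s =>
      f (p.1, p.2 + (s - p.2 0) • EuclideanSpace.single 0 1)) ?_ ?_
  · exact hf.comp (by fun_prop)
  · fun_prop

theorem hasLineDerivAt_primitive {n : ℕ} {f : ℝ × E (n + 1) → ℝ} (hf : Continuous f) (t : ℝ)
    (x : E (n + 1)) :
    HasLineDerivAt ℝ (fun y => primitive f (t, y)) (f (t, x)) x (EuclideanSpace.single 0 1) := by
  unfold HasLineDerivAt
  -- Moving `x` along the zeroth axis leaves the line of integration unchanged and shifts only the
  -- upper limit.
  have h1 : ∀ h : ℝ, primitive f (t, x + h • EuclideanSpace.single 0 1) =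
      ∫ s in (0 : ℝ)..(h + x 0), f (t, x + (s - x 0) • EuclideanSpace.single 0 1) := by
    intro h
    have h2 : (x + h • EuclideanSpace.single 0 (1 : ℝ) : E (n + 1)) 0 = h + x 0 := by
      simp [add_comm]
    simp only [primitive, h2]
    refine intervalIntegral.integral_congr fun s _ => ?_
    rw [add_assoc, ← add_smul]
    congr 4
    ring
  simp only [h1]
  have hc : Continuous fun s : ℝ => f (t, x + (s - x 0) • EuclideanSpace.single 0 (1 : ℝ)) :=
    hf.comp (by fun_prop)
  have h3 := intervalIntegral.integral_hasDerivAt_right (hc.intervalIntegrable 0 (x 0))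
    hc.aestronglyMeasurable.stronglyMeasurableAtFilter hc.continuousAt
  have h4 := HasDerivAt.comp_add_const (x := 0) (a := x 0) (by simpa using h3)
  simpa using h4

/-- Take `m` parallel to the zeroth axis with `primitive f` as its component. For `d = 0` there is
no axis and every divergence is an empty sum, hence `h0`. -/
theorem exists_divergence_eq {f : ℝ × E d → ℝ} (hf : Continuous f)
    (h0 : d = 0 → ∀ p, f p = 0) :
    ∃ m : ℝ → E d → E d, Continuous (Function.uncurry m) ∧ (∀ t x, HasDiagPartials (m t) x) ∧
      (∀ i, Continuous fun p : ℝ × E d => diagPartial (m p.1) i p.2) ∧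
      ∀ t x, divergence (m t) x = f (t, x) := by
  rcases d with _ | n
  · refine ⟨fun _ _ => 0, continuous_const, fun _ _ i => i.elim0, fun i => i.elim0, fun t x => ?_⟩
    simp [divergence, h0 rfl]
  let m : ℝ → E (n + 1) → E (n + 1) := fun t x =>
    primitive f (t, x) • EuclideanSpace.single 0 1
  have hm0 : ∀ t x, HasLineDerivAt ℝ (fun y => m t y 0) (f (t, x)) x
      (EuclideanSpace.single 0 1) := by
    intro t x
    simpa [m] using hasLineDerivAt_primitive hf t x
  have hmi : ∀ t x (i : Fin (n + 1)), i ≠ 0 → HasLineDerivAt ℝ (fun y => m t y i) 0 x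
      (EuclideanSpace.single i 1) := by
    intro t x i hi
    have : (fun y => m t y i) = fun _ => 0 := by
      ext y
      simp [m, hi]
    rw [this]
    exact hasDerivAt_const _ _
  have hdiag0 : ∀ t x, diagPartial (m t) 0 x = f (t, x) := fun t x => (hm0 t x).lineDeriv
  have hdiagi : ∀ t x (i : Fin (n + 1)), i ≠ 0 → diagPartial (m t) i x = 0 :=
    fun t x i hi => (hmi t x i hi).lineDeriv
  refine ⟨m, (continuous_primitive hf).smul continuous_const, fun t x i => ?_, fun i => ?_,
    fun t x => ?_⟩
  · by_cases hi : i = 0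
    · subst hi
      exact (hm0 t x).lineDifferentiableAt
    · exact (hmi t x i hi).lineDifferentiableAt
  · by_cases hi : i = 0
    · subst hi
      simpa only [hdiag0] using hf
    · simpa only [hdiagi _ _ i hi] using continuous_const
  · rw [divergence, Fin.sum_univ_succ, hdiag0]
    simp [hdiagi]

/-! ### Existence of an admissible pair with vanishing loss -/

/-- Clamping time to `[0,T]` extends a function from the slab to a globally continuous one without
changing it on the slab. -/
theorem continuous_comp_projIcc {X Y : Type*} [TopologicalSpace X] [TopologicalSpace Y] {T : ℝ}
    (hT : 0 ≤ T) {f : ℝ × X → Y} (hf : ContinuousOn f (Icc 0 T ×ˢ univ)) :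
    Continuous fun p : ℝ × X => f (projIcc 0 T hT p.1, p.2) :=
  hf.comp_continuous (by fun_prop) fun p => ⟨(projIcc 0 T hT p.1).2, mem_univ _⟩

theorem eq_zero_of_integral_eq_zero_of_subsingleton {X : Type*} [MeasurableSpace X]
    [Subsingleton X] {μ : Measure X} [NeZero μ] [IsFiniteMeasure μ] {f : X → ℝ}
    (hf : ∫ x, f x ∂μ = 0) (x : X) : f x = 0 := by
  have h : f = fun _ => f x := funext fun y => congrArg f (Subsingleton.elim y x)
  rw [h, integral_const, smul_eq_mul] at hf
  exact (mul_eq_zero.1 hf).resolve_left ((measureReal_univ_ne_zero (μ := μ)))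

theorem exists_admissible_residual_eq_zero
    (hU : ContDiffOn ℝ 1 (Function.uncurry U) (Icc 0 1 ×ˢ univ))
    (hZ : ∀ t ∈ Icc (0 : ℝ) 1, Integrable (fun x => Real.exp (-U t x)))
    {g : E d → ℝ} (hg : Integrable g) (hgb : ∀ t ∈ Icc (0 : ℝ) 1, ∀ x,
      |dtPotential U t x| * Real.exp (-U t x) ≤ g x) {T : ℝ} (hT : T ∈ Ioc (0 : ℝ) 1) :
    ∃ b : ℝ → E d → E d, Admissible U T b (freeEnergy U) ∧
      ∀ t ∈ Icc 0 T, ∀ x, residual U T b (freeEnergy U) t x = 0 := by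
  have hsub : Icc 0 T ⊆ Icc (0 : ℝ) 1 := Icc_subset_Icc_right hT.2
  have hslab : Icc 0 T ×ˢ (univ : Set (E d)) ⊆ Icc (0 : ℝ) 1 ×ˢ univ := prod_mono hsub subset_rfl
  -- On the slab this is `-∂_tρ_t(x)`, the divergence required of `b_t ρ_t`.
  let f : ℝ × E d → ℝ := fun p =>
    density U p.1 p.2 * (dtPotential U p.1 p.2 - dtFreeEnergy U p.1)
  have hf : ContinuousOn f (Icc 0 1 ×ˢ univ) :=
    (continuousOn_density hU hZ hg hgb).mul ((continuousOn_dtPotential hU).sub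
      ((continuousOn_dtFreeEnergy hU hZ hg hgb).comp continuousOn_fst fun p hp => hp.1))
  have hint : ∀ t ∈ Icc (0 : ℝ) 1, ∫ x, f (t, x) = 0 := fun t ht => by
    simp only [f]
    rw [integral_density_mul_dtPotential_sub hU hZ hg hgb ht, sub_self]
  obtain ⟨m, hmc, hmd, hmdc, hdiv⟩ := exists_divergence_eq
    (continuous_comp_projIcc zero_le_one hf) (by
      -- In dimension zero the space is a single point, so the zero integral forces `f` itself to
      -- vanish.
      rintro rfl p
      exact eq_zero_of_integral_eq_zero_of_subsingleton
        (f := fun x => f (projIcc 0 1 zero_le_one p.1, x))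
        (hint _ (projIcc 0 1 zero_le_one p.1).2) p.2)
  have hdiv' : ∀ t ∈ Icc (0 : ℝ) 1, ∀ x, divergence (m t) x = f (t, x) := by
    intro t ht x
    rw [hdiv]
    simp only [projIcc_of_mem zero_le_one ht]
  let b : ℝ → E d → E d := fun t x => (density U t x)⁻¹ • m t x
  have hdens : ∀ t ∈ Icc (0 : ℝ) 1, (fun x => density U t x • b t x) = m t := by
    intro t ht
    ext1 x
    exact smul_inv_smul₀ (density_pos (hZ t ht) x).ne' _
  have hinv : ContinuousOn (fun p : ℝ × E d => (density U p.1 p.2)⁻¹) (Icc 0 1 ×ˢ univ) :=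
    (continuousOn_density hU hZ hg hgb).inv₀ fun p hp => (density_pos (hZ p.1 hp.1) p.2).ne'
  have hbd : ∀ t ∈ Icc (0 : ℝ) 1, ∀ x, HasDiagPartials (b t) x :=
    fun t ht x => (hmd t x).smul (hasFDerivAt_density_inv hU ht x)
  refine ⟨b, ⟨?_, fun t ht => hbd t (hsub ht), fun i => ?_, fun t ht => ?_,
    (contDiffOn_freeEnergy hU hZ hg hgb).mono hsub, rfl⟩, fun t ht x => ?_⟩
  · exact (hinv.smul hmc.continuousOn).mono hslab
  · have hD : ContinuousOn (fun p : ℝ × E d =>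
        totalDeriv U p (0, EuclideanSpace.single i 1)) (Icc 0 1 ×ˢ univ) :=
      (continuousOn_totalDeriv hU).clm_apply continuousOn_const
    have hmi : Continuous fun p : ℝ × E d => m p.1 p.2 i :=
      (EuclideanSpace.proj (𝕜 := ℝ) i).continuous.comp hmc
    refine (((hinv.mul (hmdc i).continuousOn).add
      ((hinv.mul hD).mul hmi.continuousOn)).mono hslab).congr fun p hp => ?_
    exact (hmd p.1 p.2).diagPartial_smul (hasFDerivAt_density_inv hU (hsub hp.1) p.2) i
  · have hdt : divergence (m t) = fun x => f (t, x) := funext (hdiv' t (hsub ht))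
    -- The flux of `m_t` through large cubes tends to the integral of `f`, which is zero.
    have h := tendsto_cubeFlux (hmd t) (fun i => (hmdc i).comp (Continuous.prodMk_right t))
      (by
        rw [hdt]
        exact integrable_density_mul_dtPotential_sub hU hZ hg hgb (hsub ht) (dtFreeEnergy U t))
    rw [hdt, hint t (hsub ht)] at h
    rwa [hdens t (hsub ht)]
  · have h1 := divergence_density_smul hU (hsub ht) (hbd t (hsub ht) x)
    rw [hdens t (hsub ht), hdiv' t (hsub ht)] at h1
    have h2 := mul_left_cancel₀ (density_pos (hZ t (hsub ht)) x).ne' h1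
    have h3 : derivWithin (freeEnergy U) (Icc 0 T) t = dtFreeEnergy U t :=
      ((hasDerivWithinAt_freeEnergy hU hZ hg hgb (hsub ht)).mono hsub).derivWithin
        (uniqueDiffOn_Icc hT.1 t ht)
    rw [residual, ← h2, h3]
    ring

/-! ### Admissible pairs with vanishing loss -/

theorem pinnLoss_eq_zero {T : ℝ} {rhoHat : ℝ → E d → ℝ} {b : ℝ → E d → E d} {F : ℝ → ℝ}
    (h : ∀ t ∈ Icc 0 T, ∀ x, residual U T b F t x = 0) : pinnLoss U T rhoHat b F = 0 := by
  rw [pinnLoss, setLIntegral_congr_fun (g := fun _ => 0) measurableSet_Icc, lintegral_zero]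
  intro t ht
  simp [h t ht]

theorem Admissible.continuousOn_residual
    (hU : ContDiffOn ℝ 1 (Function.uncurry U) (Icc 0 1 ×ˢ univ)) {T : ℝ}
    (hT : T ∈ Ioc (0 : ℝ) 1) {b : ℝ → E d → E d} {F : ℝ → ℝ} (hA : Admissible U T b F) :
    ContinuousOn (fun p : ℝ × E d => residual U T b F p.1 p.2) (Icc 0 T ×ˢ univ) := by
  have hsub : Icc 0 T ⊆ Icc (0 : ℝ) 1 := Icc_subset_Icc_right hT.2
  have hslab : Icc 0 T ×ˢ (univ : Set (E d)) ⊆ Icc (0 : ℝ) 1 ×ˢ univ := prod_mono hsub subset_rfl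
  have h1 : ContinuousOn (fun p : ℝ × E d => divergence (b p.1) p.2) (Icc 0 T ×ˢ univ) :=
    continuousOn_finsetSum _ fun i _ => hA.continuousOn_diagPartial i
  have h2 : ContinuousOn (fun p : ℝ × E d => inner ℝ (gradient (U p.1) p.2) (b p.1 p.2))
      (Icc 0 T ×ˢ univ) :=
    (((continuousOn_totalDeriv hU).mono hslab).clm_apply
      (continuousOn_const.prodMk hA.continuousOn)).congr fun p hp =>
        inner_gradient_eq_totalDeriv hU (hsub hp.1) p.2 _
  have h3 : ContinuousOn (fun p : ℝ × E d => derivWithin F (Icc 0 T) p.1) (Icc 0 T ×ˢ univ) :=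
    (hA.contDiffOn.continuousOn_derivWithin (uniqueDiffOn_Icc hT.1) le_rfl).comp
      continuousOn_fst fun p hp => hp.1
  exact ((h1.sub h2).sub ((continuousOn_dtPotential hU).mono hslab)).add h3

/-- For almost every `t` the residual vanishes for almost every `x`, since `ρ̂_t > 0`. Continuity in
`x`, then in `t`, removes both exceptional sets. -/
theorem Admissible.residual_eq_zero
    (hU : ContDiffOn ℝ 1 (Function.uncurry U) (Icc 0 1 ×ˢ univ)) {T : ℝ}
    (hT : T ∈ Ioc (0 : ℝ) 1) {rhoHat : ℝ → E d → ℝ} (hrho : IsPositivePDF T rhoHat)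
    {b : ℝ → E d → E d} {F : ℝ → ℝ} (hA : Admissible U T b F)
    (hloss : pinnLoss U T rhoHat b F = 0) :
    ∀ t ∈ Icc 0 T, ∀ x, residual U T b F t x = 0 := by
  have hcont := hA.continuousOn_residual hU hT
  let r : ℝ × E d → ℝ := fun p => residual U T b F (projIcc 0 T hT.1.le p.1) p.2
  have hr : Continuous r := continuous_comp_projIcc hT.1.le hcont
  have hreq : ∀ t ∈ Icc 0 T, ∀ x, r (t, x) = residual U T b F t x := by
    intro t ht x
    simp only [r, projIcc_of_mem hT.1.le ht]
  have hmeas : Measurable fun p : ℝ × E d =>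
      ENNReal.ofReal (|r p| ^ 2 * Function.uncurry rhoHat p) :=
    ((hr.abs.pow 2).measurable.mul hrho.measurable).ennreal_ofReal
  have hloss' : ∫⁻ t in Icc 0 T, ∫⁻ x,
      ENNReal.ofReal (|r (t, x)| ^ 2 * Function.uncurry rhoHat (t, x)) = 0 := by
    rw [← hloss, pinnLoss]
    refine setLIntegral_congr_fun measurableSet_Icc fun t ht => ?_
    simp only [hreq t ht, Function.uncurry_apply_pair]
  rw [lintegral_eq_zero_iff hmeas.lintegral_prod_right'] at hloss'
  have hae : ∀ᵐ t ∂volume.restrict (Icc 0 T), ∀ x, residual U T b F t x = 0 := by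
    filter_upwards [hloss', ae_restrict_mem measurableSet_Icc] with t h0 ht
    have h1 := (lintegral_eq_zero_iff (hmeas.comp measurable_prodMk_left)).1 h0
    have h2 : (fun x => r (t, x)) =ᵐ[volume] fun _ => 0 := by
      filter_upwards [h1] with x hx
      have hx' : |r (t, x)| ^ 2 * rhoHat t x ≤ 0 := ENNReal.ofReal_eq_zero.1 hx
      have h3 : |r (t, x)| ^ 2 ≤ 0 := nonpos_of_mul_nonpos_left hx' (hrho.pos t ht x)
      simpa using le_antisymm h3 (sq_nonneg _)
    have h4 := (Continuous.ae_eq_iff_eq volume (hr.comp (Continuous.prodMk_right t))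
      continuous_const).1 h2
    intro x
    rw [← hreq t ht]
    exact congrFun h4 x
  intro t ht x
  have hx : ContinuousOn (fun t : ℝ => residual U T b F t x) (Icc 0 T) :=
    hcont.comp (f := fun t : ℝ => (t, x)) (by fun_prop) fun s hs => ⟨hs, mem_univ x⟩
  -- Here `T ≠ 0` is essential: an interval reduced to a point would be a null set.
  exact Measure.eqOn_Icc_of_ae_eq (μ := volume) hT.1.ne (hae.mono fun t h => h x) hx
    continuousOn_const ht

/-- The outward flux at infinity determines the time derivative of the learned free energy. -/
theorem Admissible.derivWithin_eq_dtFreeEnergy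
    (hU : ContDiffOn ℝ 1 (Function.uncurry U) (Icc 0 1 ×ˢ univ))
    (hZ : ∀ t ∈ Icc (0 : ℝ) 1, Integrable (fun x => Real.exp (-U t x)))
    {g : E d → ℝ} (hg : Integrable g) (hgb : ∀ t ∈ Icc (0 : ℝ) 1, ∀ x,
      |dtPotential U t x| * Real.exp (-U t x) ≤ g x) {T : ℝ} (hT : T ∈ Ioc (0 : ℝ) 1)
    {b : ℝ → E d → E d} {F : ℝ → ℝ} (hA : Admissible U T b F) (ht : t ∈ Icc 0 T)
    (hres : ∀ x, residual U T b F t x = 0) :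
    derivWithin F (Icc 0 T) t = dtFreeEnergy U t := by
  have ht1 : t ∈ Icc (0 : ℝ) 1 := Icc_subset_Icc_right hT.2 ht
  have hdiv : divergence (fun y => density U t y • b t y) = fun x =>
      density U t x * (dtPotential U t x - derivWithin F (Icc 0 T) t) := by
    ext x
    rw [divergence_density_smul hU ht1 (hA.hasDiagPartials t ht x)]
    have := hres x
    rw [residual] at this
    congr 1
    linarith
  have hρ : Continuous (density U t) :=
    (continuousOn_density hU hZ hg hgb).comp_continuous (Continuous.prodMk_right t)
      fun x => ⟨ht1, mem_univ x⟩
  have hbc : Continuous (b t) :=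
    hA.continuousOn.comp_continuous (Continuous.prodMk_right t) fun x => ⟨ht, mem_univ x⟩
  have hflux := tendsto_cubeFlux (v := fun y => density U t y • b t y)
    (fun x => (hA.hasDiagPartials t ht x).smul (hasFDerivAt_density hU ht1 x))
    (fun i => by
      have h1 : Continuous (diagPartial (b t) i) :=
        (hA.continuousOn_diagPartial i).comp_continuous (Continuous.prodMk_right t)
          fun x => ⟨ht, mem_univ x⟩
      have h2 : Continuous fun x => totalDeriv U (t, x) (0, EuclideanSpace.single i 1) :=
        ((continuousOn_totalDeriv hU).comp_continuous (Continuous.prodMk_right t)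
          fun x => ⟨ht1, mem_univ x⟩).clm_apply continuous_const
      have h3 : Continuous fun x => b t x i := (EuclideanSpace.proj (𝕜 := ℝ) i).continuous.comp hbc
      refine ((hρ.mul h1).add ((hρ.mul h2).neg.mul h3)).congr fun x => ?_
      exact ((hA.hasDiagPartials t ht x).diagPartial_smul (hasFDerivAt_density hU ht1 x) i).symm)
    (by
      rw [hdiv]
      exact integrable_density_mul_dtPotential_sub hU hZ hg hgb ht1 _)
  -- The same flux tends to the integral of the divergence and, by admissibility, to zero.
  have h0 := tendsto_nhds_unique hflux (hA.noFlux t ht)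
  rw [hdiv, integral_density_mul_dtPotential_sub hU hZ hg hgb ht1] at h0
  linarith

end NETS

/-! ### The minimum of the loss and its minimizers -/

theorem proposition4 (d : ℕ) (U : ℝ → NETS.E d → ℝ)
    (hU : ContDiffOn ℝ 1 (Function.uncurry U) (Icc 0 1 ×ˢ univ))
    (hZ : ∀ t ∈ Icc (0 : ℝ) 1, Integrable (fun x => Real.exp (-U t x)))
    (hdom : ∃ g : NETS.E d → ℝ, Integrable g ∧ ∀ t ∈ Icc (0 : ℝ) 1, ∀ x,
      |NETS.dtPotential U t x| * Real.exp (-U t x) ≤ g x)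
    (T : ℝ) (hT : T ∈ Ioc (0 : ℝ) 1)
    (rhoHat : ℝ → NETS.E d → ℝ) (hrhoHat : NETS.IsPositivePDF T rhoHat) :
    IsLeast ((fun p : (ℝ → NETS.E d → NETS.E d) × (ℝ → ℝ) =>
        NETS.pinnLoss U T rhoHat p.1 p.2) '' {p | NETS.Admissible U T p.1 p.2}) 0 ∧
    ∀ (b : ℝ → NETS.E d → NETS.E d) (F : ℝ → ℝ), NETS.Admissible U T b F →
      IsMinOn (fun p : (ℝ → NETS.E d → NETS.E d) × (ℝ → ℝ) =>
        NETS.pinnLoss U T rhoHat p.1 p.2) {p | NETS.Admissible U T p.1 p.2} (b, F) →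
      ∀ t ∈ Icc 0 T,
        (∀ x, NETS.SolvesTransportAt U b t x ∧ NETS.SolvesExpandedTransportAt U b t x) ∧
        F t = NETS.freeEnergy U t := by
  obtain ⟨g, hg, hgb⟩ := hdom
  obtain ⟨b₀, hA₀, hres₀⟩ := NETS.exists_admissible_residual_eq_zero hU hZ hg hgb hT
  have hloss₀ : NETS.pinnLoss U T rhoHat b₀ (NETS.freeEnergy U) = 0 :=
    NETS.pinnLoss_eq_zero hres₀
  refine ⟨⟨⟨(b₀, NETS.freeEnergy U), hA₀, hloss₀⟩, fun _ _ => zero_le⟩,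
    fun b F hA hmin t ht => ?_⟩
  have hsub : Icc 0 T ⊆ Icc (0 : ℝ) 1 := Icc_subset_Icc_right hT.2
  -- Comparison with the explicit zero-loss pair forces any minimizer to have zero loss.
  have hle : NETS.pinnLoss U T rhoHat b F ≤ NETS.pinnLoss U T rhoHat b₀ (NETS.freeEnergy U) :=
    isMinOn_iff.1 hmin (b₀, NETS.freeEnergy U) hA₀
  have hres := hA.residual_eq_zero hU hT hrhoHat (nonpos_iff_eq_zero.1 (hle.trans_eq hloss₀))
  have hF := fun s (hs : s ∈ Icc 0 T) =>
    hA.derivWithin_eq_dtFreeEnergy hU hZ hg hgb hT hs (hres s hs)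
  have hFE := fun s (hs : s ∈ Icc 0 T) =>
    NETS.hasDerivWithinAt_freeEnergy hU hZ hg hgb (hsub hs)
  refine ⟨fun x => ?_, ?_⟩
  · have hb := hA.hasDiagPartials t ht x
    have hr : NETS.divergence (b t) x - inner ℝ (gradient (U t) x) (b t x) =
        NETS.dtPotential U t x - NETS.dtFreeEnergy U t := by
      have := hres t ht x
      rw [NETS.residual, hF t ht] at this
      linarith
    refine ⟨⟨hb.smul (NETS.hasFDerivAt_density hU (hsub ht) x), ?_⟩, hb, ?_⟩
    · rw [NETS.divergence_density_smul hU (hsub ht) hb, hr]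
      exact NETS.hasDerivWithinAt_density hU hZ hg hgb (hsub ht) x
    · rw [hr, sub_sub_cancel]
      exact hFE t ht
  -- Both functions have derivative `dtFreeEnergy` and the same value at `0`.
  · refine eq_of_derivWithin_eq (hA.contDiffOn.differentiableOn one_ne_zero)
      (fun s hs => ((hFE s hs).mono hsub).differentiableWithinAt) (fun s hs => ?_)
      hA.initial t ht
    have hs' := Ico_subset_Icc_self hs
    rw [hF s hs', ((hFE s hs').mono hsub).derivWithin (uniqueDiffOn_Icc hT.1 s hs')]
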